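/- Let $N\ge 1$ be an integer, $T>0$, and let $A\in\mathbb R^{N\times N}$, $B\in\mathbb R^N$ be given by $A_{ij}=\sqrt{2i-1}\sqrt{2j-1}$ for $i>j$, $A_{ii}=i$, $A_{ij}=0$ for $i<j$, and $B_j=\sqrt{2j-1}$ ($1\le i,j\le N$). Let $I$ be the identity matrix and $e_1$ the first standard basis vector. For $f\colon[0,T]\to\mathbb R$ the LegS equation is $$c'(t)=-\tfrac1t A\,c(t)+\tfrac1t B f(t),\qquad t\in(0,T].$$ A solution is a function $c\colon[0,T]\to\mathbb R^N$ that is continuous on $[0,T]$, absolutely continuous on $[\varepsilon,T]$ for every $\varepsilon\in(0,T)$, and satisfies the equation for almost every $t\in(0,T]$. (No condition is imposed on $c(0)$; if $f$ is continuous at $0$, then necessarily $c(0)=f(0)e_1$.) For $n\ge1$ put $h=T/n$, $f^k=f(kh)$, $c^0=f(0)e_1$, and define $c^{k+1}$ for $k=0,\dots,n-1$ by one of the following five methods. - Forward Euler: $c^{k+1}=(I-\frac1kA)c^k+\frac1kBf^k$ for $k\ge1$, and $c^1=c^0$. - Backward Euler: $c^{k+1}=(I+\frac1{k+1}A)^{-1}c^k+(I+\frac1{k+1}A)^{-1}\frac1{k+1}Bf^{k+1}$.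 - Bilinear: $c^{k+1}=(I+\frac1{2(k+1)}A)^{-1}(I-\frac1{2k}A)c^k+(I+\frac1{2(k+1)}A)^{-1}\big(\frac1{2k}f^k+\frac1{2(k+1)}f^{k+1}\big)B$ for $k\ge1$, and $c^1=(I+\frac12A)^{-1}c^0+\frac12(I+\frac12A)^{-1}Bf^1$. - Approximate bilinear: $c^{k+1}=(I+\frac1{2(k+1)}A)^{-1}(I-\frac1{2(k+1)}A)c^k+(I+\frac1{2(k+1)}A)^{-1}\frac1{k+1}f^{k+1}B$. - Zero-order hold: $c^{k+1}=E_kc^k+A^{-1}(I-E_k)Bf^k$ with $E_k=e^{A\log(k/(k+1))}$ for $k\ge1$ and $E_0=0$. **Theorem (convergence rates of numerical solutions).** Let $f\colon[0,T]\to\mathbb R$ be of bounded variation on $[0,T]$, and let $c$ be a solution of the LegS equation. Then for each of the five methods $$\|c^n-c(T)\|=\mathcal O(1/n)\qquad\text{as } n\to\infty .$$ If moreover $f\in C^2([0,T])$, then for the bilinear method $$\|c^n-c(T)\|=\mathcal O(1/n^2)\qquad\text{as } n\to\infty .$$ Here $c^n$ is the value after $n$ steps of size $h=T/n$, $\|\cdot\|$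 is the Euclidean norm, and the implied constants may depend on $N$, $T$ and $f$. -/

import Mathlib

open scoped Matrix
open Filter Asymptotics MeasureTheory

noncomputable section

namespace LegS

/-- The LegS matrix. Rows and columns are indexed from `0`, so the index `i : Fin N` stands
for the `(i + 1)`-st row: the diagonal is `1, 2, …, N`, and the entry below the diagonal is
`√(2 i + 1) * √(2 j + 1)`. -/
def A (N : ℕ) : Matrix (Fin N) (Fin N) ℝ :=
  Matrix.of fun i j =>
    if j < i then Real.sqrt (2 * (i : ℕ) + 1) * Real.sqrt (2 * (j : ℕ) + 1)
    else if i = j then ((i : ℕ) : ℝ) + 1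
    else 0

/-- The LegS input vector, indexed from `0`. -/
def B (N : ℕ) : Fin N → ℝ := fun j => Real.sqrt (2 * (j : ℕ) + 1)

/-- The first standard basis vector. -/
def e₁ (N : ℕ) : Fin N → ℝ := fun i => if (i : ℕ) = 0 then 1 else 0

/-- `c` is a solution, in the extended sense, of the LegS equation
`c'(t) = -(1/t) A c(t) + (1/t) B f(t)` on `[0, T]` with initial value `c₀`. -/
structure IsSolution (N : ℕ) (T : ℝ) (f : ℝ → ℝ) (c₀ : Fin N → ℝ) (c : ℝ → Fin N → ℝ) :
    Prop where
  continuousOn : ContinuousOn c (Set.Icc 0 T)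
  absolutelyContinuous : ∀ ε ∈ Set.Ioo 0 T, AbsolutelyContinuousOnInterval c ε T
  ode : ∀ᵐ t ∂(volume.restrict (Set.Ioc 0 T)),
    HasDerivAt c (-(1 / t) • (A N *ᵥ c t) + (1 / t) • (f t • B N)) t
  initial : c 0 = c₀

/-- The five discretization methods. -/
inductive Scheme : Type
  | forwardEuler
  | backwardEuler
  | bilinear
  | approxBilinear
  | zeroOrderHold

/-- The matrix `exp (A log (k / (k + 1)))`, with the convention that it is `0` for `k = 0`. -/
def zohMatrix (N k : ℕ) : Matrix (Fin N) (Fin N) ℝ :=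
  if k = 0 then 0 else NormedSpace.exp (Real.log ((k : ℝ) / ((k : ℝ) + 1)) • A N)

/-- One step of a method: the value `c^{k+1}` computed from `v = c^k`, `f₀ = f^k` and
`f₁ = f^{k+1}`. In step `0` of the forward Euler and of the bilinear method the terms
that contain `1 / k` are set to zero. -/
def step (N : ℕ) : Scheme → (k : ℕ) → (v : Fin N → ℝ) → (f₀ f₁ : ℝ) → (Fin N → ℝ)
  | .forwardEuler, k, v, f₀, _ =>
      if k = 0 then v
      else (1 - (1 / (k : ℝ)) • A N) *ᵥ v + (1 / (k : ℝ)) • (f₀ • B N)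
  | .backwardEuler, k, v, _, f₁ =>
      (1 + (1 / ((k : ℝ) + 1)) • A N)⁻¹ *ᵥ v
        + (1 + (1 / ((k : ℝ) + 1)) • A N)⁻¹ *ᵥ ((1 / ((k : ℝ) + 1)) • (f₁ • B N))
  | .bilinear, k, v, f₀, f₁ =>
      if k = 0 then
        (1 + (1 / 2 : ℝ) • A N)⁻¹ *ᵥ v
          + (1 / 2 : ℝ) • ((1 + (1 / 2 : ℝ) • A N)⁻¹ *ᵥ (f₁ • B N))
      else
        (1 + (1 / (2 * ((k : ℝ) + 1))) • A N)⁻¹ *ᵥ ((1 - (1 / (2 * (k : ℝ))) • A N) *ᵥ v)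
          + (1 + (1 / (2 * ((k : ℝ) + 1))) • A N)⁻¹ *ᵥ
              ((1 / (2 * (k : ℝ)) * f₀ + 1 / (2 * ((k : ℝ) + 1)) * f₁) • B N)
  | .approxBilinear, k, v, _, f₁ =>
      (1 + (1 / (2 * ((k : ℝ) + 1))) • A N)⁻¹ *ᵥ
          ((1 - (1 / (2 * ((k : ℝ) + 1))) • A N) *ᵥ v)
        + (1 + (1 / (2 * ((k : ℝ) + 1))) • A N)⁻¹ *ᵥ ((1 / ((k : ℝ) + 1) * f₁) • B N)
  | .zeroOrderHold, k, v, f₀, _ =>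
      zohMatrix N k *ᵥ v + (A N)⁻¹ *ᵥ ((1 - zohMatrix N k) *ᵥ (f₀ • B N))

/-- The iterates `c^0, c^1, c^2, …` of a method with step size `h` and input `f`, started
from `c^0 = f(0) e₁`. -/
def iterate (N : ℕ) (s : Scheme) (f : ℝ → ℝ) (h : ℝ) : ℕ → (Fin N → ℝ)
  | 0 => f 0 • e₁ N
  | k + 1 => step N s k (iterate N s f h k) (f (k * h)) (f ((k + 1) * h))

/-- The global error at the endpoint `t_n = T`, in the Euclidean norm, of a method with
`n` steps of size `T / n`, for the exact solution `c`. -/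
def globalError (N : ℕ) (s : Scheme) (T : ℝ) (f : ℝ → ℝ) (c : ℝ → Fin N → ℝ) (n : ℕ) : ℝ :=
  ‖WithLp.toLp 2 (iterate N s f (T / n) n - c T)‖

end LegS

end

/-!
The matrix `A` is triangular with the distinct diagonal entries `1, …, N`, so it has a basis of left
eigenvectors (`LegS.exists_diagonalization`). Since `A e₁ = B`, pairing the equation with a left
eigenvector `w` for the eigenvalue `m` turns it into the scalar equation `x' = -(m / t) (x - g)` with
`g = (w ⬝ e₁) f`, and turns each of the methods into a scalar recursion
`X (k + 1) = R k * X k + (1 - R k - q k) * g (k h) + q k * g ((k + 1) h)`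
(`LegS.row_dotProduct_iterate`). It remains to bound the scalar errors.

*The exact solution.* As `(t ^ m (x - g₀))' = m t ^ (m - 1) (g - g₀)` for a constant `g₀`, the exact
step has the factor `r k = (k / (k + 1)) ^ m`, up to `1 - r k` times the oscillation of `g` on the
step; the same holds relative to the solution for a linear input
(`LegS.IsScalarSolution.abs_step_sub_le`). Because `r 0 = 0`, the value at the singular point
`t = 0` plays no role.

*Stability.* Every method has `R k = r k + O(1 / k ^ 2)` with `r k ≤ k / (k + 1)`, so `k` times the
error at step `k` grows by a factor `1 + O(1 / k ^ 2)` per step, and a discrete Grönwall inequality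
applies (`LegS.succ_mul_abs_error_le`): `n` times the final error is at most a constant times the
sum of `k` times the local error of step `k`.

*Bounded variation.* With `V k` the variation of `g` on step `k` and `E k = x (k h) - g (k h)`, the
local error is `O(|E k| / k ^ 2 + V k / k)`. The crude bound `E k = O(1)` would cost a factor
`log n`. Instead, `|E (k + 1)| ≤ k / (k + 1) |E k| + 2 V k`, which telescopes to
`∑ |E k| / (k + 1) ≤ 2 ∑ V k`; hence `n` times the error is bounded by a multiple of the total
variation (`LegS.exists_scalar_error_le`).

*The bilinear method for `C²` input.* Here `R k = r k + O(1 / k ^ 3)`, and the method is exact for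
linear inputs after the first step. Comparing `g` on step `k` with its tangent at `k h`, from which
the solution differs by `O((k h) ^ 2)` at `k h`, gives a local error `O(h ^ 2 / k)`, so `n` times
the error is `O(h)`; the first step contributes `O(h)` as well
(`LegS.exists_scalar_bilinear_error_le`).
-/

namespace LegS

/-! ### The scalar form of the five methods -/

/-- The factor by which one step of the method `s` multiplies the current value when the method is
applied to the scalar equation `x' = -(m / t) (x - g)`. For `k = 0` the quotients by `k` are `0`,
which is precisely the convention of `step`. -/
noncomputable def decay (s : Scheme) (m k : ℕ) : ℝ :=
  match s with
  | .forwardEuler => 1 - m / k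
  | .backwardEuler => 1 / (1 + m / (k + 1))
  | .bilinear => (1 - m / (2 * k)) / (1 + m / (2 * (k + 1)))
  | .approxBilinear => (1 - m / (2 * (k + 1))) / (1 + m / (2 * (k + 1)))
  | .zeroOrderHold => ((k : ℝ) / (k + 1)) ^ m

/-- The weight that one step of the method `s`, applied to the scalar equation
`x' = -(m / t) (x - g)`, gives to the value of `g` at the end of the step. -/
noncomputable def newWeight (s : Scheme) (m k : ℕ) : ℝ :=
  match s with
  | .forwardEuler => 0
  | .backwardEuler => (m / (k + 1)) / (1 + m / (k + 1))
  | .bilinear => (m / (2 * (k + 1))) / (1 + m / (2 * (k + 1)))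
  | .approxBilinear => (m / (k + 1)) / (1 + m / (2 * (k + 1)))
  | .zeroOrderHold => 0

/-- The iterates of the method `s` for the scalar equation `x' = -(m / t) (x - g)`. Constants are
fixed points of every step, so the three weights of a step add up to `1`. -/
noncomputable def scalarIterate (s : Scheme) (m : ℕ) (g : ℝ → ℝ) (h : ℝ) : ℕ → ℝ
  | 0 => g 0
  | k + 1 => decay s m k * scalarIterate s m g h k
      + (1 - decay s m k - newWeight s m k) * g (k * h) + newWeight s m k * g ((k + 1) * h)

lemma newWeight_nonneg (s : Scheme) (m k : ℕ) : 0 ≤ newWeight s m k := by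
  cases s <;> simp only [newWeight] <;> positivity

lemma newWeight_le (s : Scheme) (m k : ℕ) : newWeight s m k ≤ m / (k + 1) := by
  cases s <;> simp only [newWeight]
  case forwardEuler => positivity
  case zeroOrderHold => positivity
  case backwardEuler => exact div_le_self (by positivity) (le_add_of_nonneg_right (by positivity))
  case approxBilinear => exact div_le_self (by positivity) (le_add_of_nonneg_right (by positivity))
  case bilinear =>
    refine (div_le_self (by positivity) (le_add_of_nonneg_right (by positivity))).trans ?_
    gcongr
    linarith [Nat.cast_nonneg (α := ℝ) k]

lemma abs_one_sub_pow_sub_linear_le (m : ℕ) {z : ℝ} (h0 : 0 ≤ z) (h1 : z ≤ 1) :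
    |(1 - z) ^ m - (1 - m * z)| ≤ m ^ 2 * z ^ 2 := by
  induction m with
  | zero => simp
  | succ m ih =>
    have e : (1 - z) ^ (m + 1) - (1 - (m + 1 : ℕ) * z)
        = (1 - z) * ((1 - z) ^ m - (1 - m * z)) + m * z ^ 2 := by push_cast; ring
    rw [e]
    calc _ ≤ |(1 - z) * ((1 - z) ^ m - (1 - m * z))| + |m * z ^ 2| := abs_add_le _ _
      _ ≤ 1 * (m ^ 2 * z ^ 2) + m * z ^ 2 := by
        rw [abs_mul, abs_of_nonneg (sub_nonneg.2 h1), abs_of_nonneg (by positivity : 0 ≤ m * z ^ 2)]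
        gcongr
        linarith
      _ ≤ _ := by
        push_cast
        nlinarith [mul_nonneg (Nat.cast_nonneg (α := ℝ) m) (sq_nonneg z), sq_nonneg z]

lemma abs_one_sub_pow_sub_quadratic_le (m : ℕ) {z : ℝ} (h0 : 0 ≤ z) (h1 : z ≤ 1) :
    |(1 - z) ^ m - (1 - m * z + m * (m - 1) / 2 * z ^ 2)| ≤ m ^ 3 * z ^ 3 := by
  induction m with
  | zero => simp
  | succ m ih =>
    have e : (1 - z) ^ (m + 1)
          - (1 - (m + 1 : ℕ) * z + (m + 1 : ℕ) * ((m + 1 : ℕ) - 1) / 2 * z ^ 2)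
        = (1 - z) * ((1 - z) ^ m - (1 - m * z + m * (m - 1) / 2 * z ^ 2))
          - m * (m - 1) / 2 * z ^ 3 := by push_cast; ring
    have hm : |(m : ℝ) * (m - 1) / 2| ≤ m ^ 2 + m := by
      rw [abs_le]
      constructor <;> nlinarith [Nat.cast_nonneg (α := ℝ) m]
    rw [e]
    calc _ ≤ |(1 - z) * ((1 - z) ^ m - (1 - m * z + m * (m - 1) / 2 * z ^ 2))|
            + |(m : ℝ) * (m - 1) / 2 * z ^ 3| := abs_sub _ _
      _ ≤ 1 * (m ^ 3 * z ^ 3) + (m ^ 2 + m) * z ^ 3 := by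
        rw [abs_mul, abs_mul _ (z ^ 3), abs_of_nonneg (sub_nonneg.2 h1),
          abs_of_nonneg (by positivity : 0 ≤ z ^ 3)]
        gcongr
        linarith
      _ ≤ _ := by
        push_cast
        have h3 : 0 ≤ z ^ 3 := by positivity
        nlinarith [mul_nonneg (Nat.cast_nonneg (α := ℝ) m) h3,
          mul_nonneg (sq_nonneg (m : ℝ)) h3]

lemma div_succ_eq_one_sub (k : ℕ) : (k : ℝ) / (k + 1) = 1 - 1 / (k + 1) := by
  field_simp
  ring

/-- The bilinear method has consistency order two: its decay factor agrees with the exact one,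
`(k / (k + 1)) ^ m`, up to third order in `1 / (k + 1)`. -/
lemma exists_decay_bilinear_sub_le (m : ℕ) : ∃ K : ℝ, 0 ≤ K ∧ ∀ k : ℕ, 1 ≤ k →
    |decay .bilinear m k - ((k : ℝ) / (k + 1)) ^ m| ≤ K / (k + 1) ^ 3 := by
  refine ⟨(m + m ^ 2 + m ^ 3 + m ^ 3 : ℝ), by positivity, fun k hk => ?_⟩
  have hk' : (1 : ℝ) ≤ k := by exact_mod_cast hk
  obtain ⟨z, hz⟩ : ∃ z : ℝ, z = 1 / (k + 1) := ⟨_, rfl⟩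
  have hz0 : 0 < z := by rw [hz]; positivity
  have hz1 : z ≤ 1 / 2 := by
    rw [hz]; exact one_div_le_one_div_of_le (by norm_num) (by linarith)
  have hpow := abs_one_sub_pow_sub_quadratic_le m hz0.le (by linarith)
  rw [div_succ_eq_one_sub, ← hz]
  have hkz : (k : ℝ) = (1 - z) / z := by rw [hz]; field_simp; ring
  have hk1 : (k : ℝ) + 1 = 1 / z := by rw [hz]; field_simp
  have hm : (0 : ℝ) ≤ m := Nat.cast_nonneg m
  have hz' : 0 < 1 - z := by linarith
  have hR : decay .bilinear m k - (1 - m * z + m * (m - 1) / 2 * z ^ 2)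
      = (m ^ 2 / 4 - m ^ 3 / 4 - m / 2 / (1 - z)) * z ^ 3 / (1 + m * z / 2) := by
    have : 0 < 1 + m * z / 2 := by positivity
    have : 0 < 2 + m * z := by positivity
    simp only [decay]
    rw [hk1, hkz]
    field_simp
    ring
  have hq : |(m : ℝ) ^ 2 / 4 - m ^ 3 / 4 - m / 2 / (1 - z)| ≤ (m + m ^ 2 + m ^ 3 : ℝ) := by
    have h1 : (m : ℝ) / 2 / (1 - z) ≤ m := by
      rw [div_le_iff₀ hz']; nlinarith
    have h2 : 0 ≤ (m : ℝ) / 2 / (1 - z) := by positivity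
    rw [abs_le]
    constructor <;> nlinarith [pow_nonneg hm 2, pow_nonneg hm 3]
  have hR' : |decay .bilinear m k - (1 - m * z + m * (m - 1) / 2 * z ^ 2)|
      ≤ (m + m ^ 2 + m ^ 3) * z ^ 3 := by
    rw [hR, abs_div, abs_of_pos (by positivity : 0 < 1 + m * z / 2), abs_mul,
      abs_of_pos (by positivity : 0 < z ^ 3)]
    refine (div_le_self (by positivity) (le_add_of_nonneg_right (by positivity))).trans ?_
    gcongr
  rw [hk1]
  calc _ = |(decay .bilinear m k - (1 - m * z + m * (m - 1) / 2 * z ^ 2))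
        - ((1 - z) ^ m - (1 - m * z + m * (m - 1) / 2 * z ^ 2))| := by congr 1; ring
    _ ≤ (m + m ^ 2 + m ^ 3) * z ^ 3 + m ^ 3 * z ^ 3 :=
        (abs_sub _ _).trans (add_le_add hR' hpow)
    _ = _ := by field_simp

/-- All five methods are consistent: their decay factors agree with the exact one,
`(k / (k + 1)) ^ m`, up to second order in `1 / (k + 1)`. -/
lemma exists_decay_sub_le (s : Scheme) (m : ℕ) : ∃ K : ℝ, 0 ≤ K ∧ ∀ k : ℕ, 1 ≤ k →
    |decay s m k - ((k : ℝ) / (k + 1)) ^ m| ≤ K / (k + 1) ^ 2 := by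
  -- It suffices to compare with the linear part `1 - m / (k + 1)` of the exact factor.
  have key : ∀ K₀ : ℝ, 0 ≤ K₀ → (∀ k : ℕ, 1 ≤ k →
      |decay s m k - (1 - m * (1 / (k + 1)))| ≤ K₀ * (1 / (k + 1)) ^ 2) →
      ∃ K : ℝ, 0 ≤ K ∧ ∀ k : ℕ, 1 ≤ k →
        |decay s m k - ((k : ℝ) / (k + 1)) ^ m| ≤ K / (k + 1) ^ 2 := by
    intro K₀ hK₀ H
    refine ⟨K₀ + m ^ 2, by positivity, fun k hk => ?_⟩
    have hpow := abs_one_sub_pow_sub_linear_le m (z := 1 / ((k : ℝ) + 1)) (by positivity)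
      (by rw [div_le_one (by positivity)]; linarith [Nat.cast_nonneg (α := ℝ) k])
    rw [div_succ_eq_one_sub]
    calc _ = |(decay s m k - (1 - m * (1 / (k + 1))))
          - ((1 - 1 / ((k : ℝ) + 1)) ^ m - (1 - m * (1 / (k + 1))))| := by congr 1; ring
      _ ≤ K₀ * (1 / (k + 1)) ^ 2 + m ^ 2 * (1 / (k + 1)) ^ 2 :=
          (abs_sub _ _).trans (add_le_add (H k hk) hpow)
      _ = _ := by field_simp
  cases s
  case forwardEuler =>
    refine key (2 * m) (by positivity) fun k hk => ?_
    have hk' : (1 : ℝ) ≤ k := by exact_mod_cast hk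
    have e : decay .forwardEuler m k - (1 - m * (1 / (k + 1))) = -(m / (k * (k + 1))) := by
      simp only [decay]
      field_simp
      ring
    rw [e, abs_neg, abs_of_nonneg (by positivity), div_pow, one_pow, mul_one_div,
      div_le_div_iff₀ (by positivity) (by positivity)]
    nlinarith [mul_nonneg (mul_nonneg (Nat.cast_nonneg (α := ℝ) m)
      (by linarith : (0 : ℝ) ≤ k + 1)) (sub_nonneg.2 hk')]
  case backwardEuler =>
    refine key (m ^ 2) (by positivity) fun k hk => ?_
    have e : decay .backwardEuler m k - (1 - m * (1 / (k + 1)))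
        = m ^ 2 * (1 / (k + 1)) ^ 2 / (1 + m / (k + 1)) := by
      have : (0 : ℝ) < 1 + m / (k + 1) := by positivity
      have : (0 : ℝ) < k + 1 + m := by positivity
      simp only [decay]
      field_simp
      ring
    rw [e, abs_of_nonneg (by positivity)]
    exact div_le_self (by positivity) (le_add_of_nonneg_right (by positivity))
  case approxBilinear =>
    refine key (m ^ 2) (by positivity) fun k hk => ?_
    have e : decay .approxBilinear m k - (1 - m * (1 / (k + 1)))
        = m ^ 2 * (1 / (k + 1)) ^ 2 / 2 / (1 + m / (2 * (k + 1))) := by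
      have : (0 : ℝ) < 1 + m / (2 * (k + 1)) := by positivity
      have : (0 : ℝ) < 2 * (k + 1) + m := by positivity
      simp only [decay]
      field_simp
      ring
    rw [e, abs_of_nonneg (by positivity)]
    exact (div_le_self (by positivity) (le_add_of_nonneg_right (by positivity))).trans
      (half_le_self (by positivity))
  case zeroOrderHold => exact ⟨0, le_rfl, fun k _ => by simp [decay]⟩
  case bilinear =>
    obtain ⟨K, hK, H⟩ := exists_decay_bilinear_sub_le m
    refine ⟨K, hK, fun k hk => (H k hk).trans ?_⟩
    gcongr
    · linarith [Nat.cast_nonneg (α := ℝ) k]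
    · norm_num

/-! ### Stability -/

lemma le_exp_sum_mul_of_le_one_add_mul {a b d : ℕ → ℝ} (n : ℕ) (ha : 0 ≤ a 0)
    (hb : ∀ k, 0 ≤ b k) (hd : ∀ k, 0 ≤ d k)
    (h : ∀ k < n, a (k + 1) ≤ (1 + b k) * a k + d k) :
    a n ≤ Real.exp (∑ k ∈ Finset.range n, b k) * (a 0 + ∑ k ∈ Finset.range n, d k) := by
  induction n with
  | zero => simp
  | succ n ih =>
    rw [Finset.sum_range_succ, Finset.sum_range_succ, Real.exp_add]
    have hS : 0 ≤ a 0 + ∑ k ∈ Finset.range n, d k :=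
      add_nonneg ha (Finset.sum_nonneg fun k _ => hd k)
    have hb' : 1 + b n ≤ Real.exp (b n) := by linarith [Real.add_one_le_exp (b n)]
    have h1 : 1 ≤ Real.exp (∑ k ∈ Finset.range n, b k) * Real.exp (b n) := by
      rw [← Real.exp_add]
      exact Real.one_le_exp (add_nonneg (Finset.sum_nonneg fun k _ => hb k) (hb n))
    calc a (n + 1) ≤ (1 + b n) * a n + d n := h n (Nat.lt_succ_self n)
      _ ≤ Real.exp (b n) * (Real.exp (∑ k ∈ Finset.range n, b k)
            * (a 0 + ∑ k ∈ Finset.range n, d k))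
          + Real.exp (∑ k ∈ Finset.range n, b k) * Real.exp (b n) * d n := by
        refine add_le_add ((mul_le_mul_of_nonneg_left
          (ih fun k hk => h k (hk.trans n.lt_succ_self)) (by linarith [hb n])).trans
          (mul_le_mul_of_nonneg_right hb' (by positivity))) ?_
        exact le_mul_of_one_le_left (hd n) h1
      _ = _ := by ring

/-- Stability with decay: an error committed in step `k` is damped by the factor `k / n`, up to a
constant, before the `n`-th step. -/
lemma succ_mul_abs_error_le {R e τ : ℕ → ℝ} {K : ℝ} (hK : 0 ≤ K) (n : ℕ)
    (hR : ∀ k, 1 ≤ k → |R k| ≤ k / (k + 1) + K / (k + 1) ^ 2)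
    (he : ∀ k, 1 ≤ k → k ≤ n → e (k + 1) = R k * e k + τ k) :
    (n + 1) * |e (n + 1)| ≤ Real.exp K *
      (|e 1| + ∑ j ∈ Finset.range n, ((j : ℝ) + 2) * |τ (j + 1)|) := by
  have hsum : ∑ j ∈ Finset.range n, K / (((j : ℝ) + 1) * (j + 2)) ≤ K := by
    have : ∀ n : ℕ, ∑ j ∈ Finset.range n, K / (((j : ℝ) + 1) * (j + 2)) = K - K / (n + 1) := by
      intro n
      induction n with
      | zero => simp
      | succ n ih => rw [Finset.sum_range_succ, ih]; push_cast; field_simp; ring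
    rw [this]
    exact sub_le_self _ (by positivity)
  have := le_exp_sum_mul_of_le_one_add_mul (a := fun j : ℕ => ((j : ℝ) + 1) * |e (j + 1)|)
    (b := fun j : ℕ => K / (((j : ℝ) + 1) * (j + 2))) (d := fun j => ((j : ℝ) + 2) * |τ (j + 1)|)
    n (by positivity) (fun k => by positivity) (fun k => by positivity) (fun k hk => by
      have h1 := hR (k + 1) (by omega)
      rw [he (k + 1) (by omega) (by omega)]
      push_cast at h1 ⊢
      calc ((k : ℝ) + 1 + 1) * |R (k + 1) * e (k + 1) + τ (k + 1)|
          ≤ (k + 1 + 1) * (((k + 1) / (k + 1 + 1) + K / (k + 1 + 1) ^ 2) * |e (k + 1)|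
            + |τ (k + 1)|) := by
            gcongr
            refine (abs_add_le _ _).trans ?_
            rw [abs_mul]
            gcongr
        _ = _ := by field_simp; ring)
  simp only [Nat.cast_zero, zero_add, one_mul] at this
  refine this.trans ?_
  gcongr

/-! ### The exact solution of the scalar equation -/

/-- `x` is a solution of the scalar equation `x' = -(m / t) (x - g)` on `[0, T]`, in the same sense
as in `IsSolution`. -/
structure IsScalarSolution (m : ℕ) (T : ℝ) (g x : ℝ → ℝ) : Prop where
  continuousOn : ContinuousOn x (Set.Icc 0 T)
  absolutelyContinuous : ∀ ε ∈ Set.Ioo 0 T, AbsolutelyContinuousOnInterval x ε T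
  ode : ∀ᵐ t ∂(volume.restrict (Set.Ioc 0 T)), HasDerivAt x (-(m / t) * (x t - g t)) t

lemma absolutelyContinuousOnInterval_of_contDiff {u : ℝ → ℝ} (hu : ContDiff ℝ 1 u) (a b : ℝ) :
    AbsolutelyContinuousOnInterval u a b := by
  obtain ⟨K, hK⟩ := hu.contDiffOn.exists_lipschitzOnWith (s := Set.uIcc a b) one_ne_zero
    (convex_uIcc a b) isCompact_uIcc
  exact hK.absolutelyContinuousOnInterval

/-- For the linear input `α + β t` the function `α + m / (m + 1) β t` is an exact solution; this
compares with it the solution for an input that is uniformly close to `α + β t`. -/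
lemma IsScalarSolution.abs_pow_mul_sub_le {m : ℕ} {T : ℝ} {g x : ℝ → ℝ}
    (hx : IsScalarSolution m T g x) (hm : 1 ≤ m) {a b : ℝ} (ha : 0 ≤ a) (hab : a ≤ b) (hb : b ≤ T)
    {α β D : ℝ} (hD : ∀ t ∈ Set.Icc a b, |g t - (α + β * t)| ≤ D) :
    |b ^ m * (x b - (α + m / (m + 1) * β * b)) - a ^ m * (x a - (α + m / (m + 1) * β * a))|
      ≤ D * (b ^ m - a ^ m) := by
  obtain ⟨Y, hY⟩ : ∃ Y : ℝ → ℝ, Y = fun t => t ^ m * (x t - (α + m / (m + 1) * β * t)) := ⟨_, rfl⟩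
  -- Away from the singularity the fundamental theorem of calculus applies to `Y`.
  have pos : ∀ a' : ℝ, 0 < a' → a ≤ a' → a' ≤ b → |Y b - Y a'| ≤ D * (b ^ m - a' ^ m) := by
    intro a' ha' haa' hab'
    rcases hab'.eq_or_lt with rfl | hlt
    · simp
    have hYac : AbsolutelyContinuousOnInterval Y a' b := by
      have h1 := (hx.absolutelyContinuous a' ⟨ha', hlt.trans_le hb⟩).mono (c := a') (d := b)
        (by rw [Set.uIcc_of_le hab', Set.uIcc_of_le (hab'.trans hb)]
            exact Set.Icc_subset_Icc_right hb)
      rw [hY]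
      exact (absolutelyContinuousOnInterval_of_contDiff (by fun_prop) a' b).mul
        (h1.sub (absolutelyContinuousOnInterval_of_contDiff (by fun_prop) a' b))
    have hder : ∀ᵐ t ∂volume.restrict (Set.Ioc a' b),
        ‖deriv Y t‖ ≤ D * (m * t ^ (m - 1)) := by
      have hsub : Set.Ioc a' b ⊆ Set.Ioc 0 T := Set.Ioc_subset_Ioc ha'.le hb
      filter_upwards [ae_restrict_of_ae_restrict_of_subset hsub hx.ode,
        ae_restrict_mem measurableSet_Ioc] with t ht htm
      have ht0 : 0 < t := ha'.trans htm.1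
      have h2 : HasDerivAt Y (m * t ^ (m - 1) * (g t - (α + β * t))) t := by
        have h3 := (hasDerivAt_pow m t).mul
          (ht.sub (((hasDerivAt_id t).const_mul (m / (m + 1) * β)).const_add α))
        rw [hY]
        refine h3.congr_deriv ?_
        obtain ⟨l, rfl⟩ : ∃ l, m = l + 1 := ⟨m - 1, by omega⟩
        simp only [Nat.add_sub_cancel, id, Pi.sub_apply]
        push_cast
        field_simp
        ring
      rw [h2.deriv, norm_mul, Real.norm_of_nonneg (by positivity), mul_comm]
      exact mul_le_mul_of_nonneg_right (hD t ⟨haa'.trans htm.1.le, htm.2⟩) (by positivity)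
    have hint : ∫ t in a'..b, D * (m * t ^ (m - 1)) = D * (b ^ m - a' ^ m) := by
      rw [mul_sub]
      exact intervalIntegral.integral_eq_sub_of_hasDerivAt (f := fun t => D * t ^ m)
        (fun t _ => (hasDerivAt_pow m t).const_mul D)
        (Continuous.intervalIntegrable (by fun_prop) _ _)
    rw [← hYac.integral_deriv_eq_sub, ← hint]
    exact intervalIntegral.norm_integral_le_of_norm_le hab'
      ((ae_restrict_iff' measurableSet_Ioc).1 hder)
      (Continuous.intervalIntegrable (by fun_prop) _ _)
  have goal : |Y b - Y a| ≤ D * (b ^ m - a ^ m) := by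
    rcases ha.eq_or_lt with rfl | ha'
    · -- At the singularity the estimate follows by continuity.
      rcases hab.eq_or_lt with rfl | hb0
      · simp
      have hYc : ContinuousWithinAt Y (Set.Icc 0 b) 0 := by
        rw [hY]
        refine ContinuousWithinAt.mul (by fun_prop) (ContinuousWithinAt.sub ?_ (by fun_prop))
        exact (hx.continuousOn.mono (Set.Icc_subset_Icc_right hb)) 0 ⟨le_rfl, hab⟩
      have hmem : Set.Ioc 0 b ∈ nhdsWithin 0 (Set.Ioi (0 : ℝ)) := Ioc_mem_nhdsGT hb0
      have hYt : Tendsto Y (nhdsWithin 0 (Set.Ioi (0 : ℝ))) (nhds (Y 0)) := by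
        rw [← nhdsWithin_Ioc_eq_nhdsGT hb0]
        exact hYc.mono Set.Ioc_subset_Icc_self
      have hpt : Tendsto (fun t : ℝ => D * (b ^ m - t ^ m)) (nhdsWithin 0 (Set.Ioi (0 : ℝ)))
          (nhds (D * (b ^ m - 0 ^ m))) :=
        ((by fun_prop : Continuous fun t : ℝ => D * (b ^ m - t ^ m)).tendsto 0).mono_left
          nhdsWithin_le_nhds
      refine le_of_tendsto_of_tendsto (tendsto_const_nhds.sub hYt).abs hpt ?_
      filter_upwards [hmem] with t ht
      exact pos t ht.1 ht.1.le ht.2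
    · exact pos a ha' le_rfl hab
  rw [hY] at goal
  exact goal

/-- The comparison with a linear input over one step of length `h`. For `k = 0` the value of the
solution at `0` drops out, so it is irrelevant. -/
lemma IsScalarSolution.abs_step_sub_le {m : ℕ} {T : ℝ} {g x : ℝ → ℝ}
    (hx : IsScalarSolution m T g x) (hm : 1 ≤ m) {h : ℝ} (hh : 0 < h) {k : ℕ}
    (hk : ((k : ℝ) + 1) * h ≤ T) {α β D : ℝ}
    (hD : ∀ t ∈ Set.Icc (k * h) ((k + 1) * h), |g t - (α + β * t)| ≤ D) :
    |(x ((k + 1) * h) - (α + m / (m + 1) * β * ((k + 1) * h)))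
        - ((k : ℝ) / (k + 1)) ^ m * (x (k * h) - (α + m / (m + 1) * β * (k * h)))|
      ≤ D * (1 - ((k : ℝ) / (k + 1)) ^ m) := by
  have H := hx.abs_pow_mul_sub_le hm (by positivity) (by nlinarith) hk hD
  have hp : 0 < (((k : ℝ) + 1) * h) ^ m := by positivity
  have hr : ((k : ℝ) / (k + 1)) ^ m * (((k : ℝ) + 1) * h) ^ m = (k * h) ^ m := by
    rw [← mul_pow]; congr 1; field_simp
  rw [← hr] at H
  refine le_of_mul_le_mul_left ?_ hp
  calc _ = |(((k : ℝ) + 1) * h) ^ m * ((x ((k + 1) * h) - (α + m / (m + 1) * β * ((k + 1) * h)))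
        - ((k : ℝ) / (k + 1)) ^ m * (x (k * h) - (α + m / (m + 1) * β * (k * h))))| := by
        rw [abs_mul, abs_of_pos hp]
    _ ≤ _ := by
      convert H using 1
      congr 1
      ring
    _ = _ := by ring

lemma one_sub_div_succ_pow_le (m k : ℕ) : 1 - ((k : ℝ) / (k + 1)) ^ m ≤ m / (k + 1) := by
  have h1 : (1 : ℝ) / (k + 1) ≤ 1 := by
    rw [div_le_one (by positivity)]; linarith [Nat.cast_nonneg (α := ℝ) k]
  have := one_add_mul_le_pow (a := -(1 / ((k : ℝ) + 1))) (by linarith) m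
  rw [div_succ_eq_one_sub, sub_eq_add_neg (1 : ℝ) (1 / _)]
  have e : (m : ℝ) / (k + 1) = m * (1 / (k + 1)) := by ring
  rw [e]
  linarith

lemma div_succ_pow_le {m : ℕ} (hm : 1 ≤ m) (k : ℕ) : ((k : ℝ) / (k + 1)) ^ m ≤ k / (k + 1) :=
  pow_le_of_le_one (by positivity)
    (by rw [div_le_one (by positivity)]; linarith [Nat.cast_nonneg (α := ℝ) k]) (by omega)

lemma abs_decay_le {s : Scheme} {m : ℕ} (hm : 1 ≤ m) {K : ℝ} {k : ℕ}
    (hK : |decay s m k - ((k : ℝ) / (k + 1)) ^ m| ≤ K / (k + 1) ^ 2) :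
    |decay s m k| ≤ k / (k + 1) + K / (k + 1) ^ 2 := by
  have h1 := abs_add_le (decay s m k - ((k : ℝ) / (k + 1)) ^ m) (((k : ℝ) / (k + 1)) ^ m)
  rw [sub_add_cancel, abs_of_nonneg (by positivity : 0 ≤ ((k : ℝ) / (k + 1)) ^ m)] at h1
  linarith [div_succ_pow_le hm k]

/-! ### Error of the scalar methods -/

/-- After one step the iterate and the exact solution are both close to `g 0`, whatever the value of
the solution at `0` is. -/
lemma abs_scalarIterate_one_sub_le {m : ℕ} (hm : 1 ≤ m) (s : Scheme) {T h V : ℝ} {g x : ℝ → ℝ}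
    (hx : IsScalarSolution m T g x) (hh : 0 < h) (hT : h ≤ T)
    (hV : ∀ t ∈ Set.Icc 0 h, |g t - g 0| ≤ V) :
    |scalarIterate s m g h 1 - x h| ≤ (m + 1) * V := by
  have hV0 : 0 ≤ V := (abs_nonneg _).trans (hV 0 ⟨le_rfl, hh.le⟩)
  have hxh := hx.abs_step_sub_le hm hh (k := 0) (α := g 0) (β := 0) (D := V)
    (by simpa using hT) (by simpa using hV)
  have hm0 : m ≠ 0 := by omega
  simp only [Nat.cast_zero, zero_add, one_mul, mul_zero, zero_mul, add_zero, zero_div,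
    zero_pow hm0, sub_zero, mul_one] at hxh
  have hq := newWeight_le s m 0
  have hq0 := newWeight_nonneg s m 0
  simp only [Nat.cast_zero, zero_add, div_one] at hq
  have e : scalarIterate s m g h 1 - x h
      = newWeight s m 0 * (g h - g 0) - (x h - g 0) := by
    simp only [scalarIterate, Nat.cast_zero, zero_mul, zero_add, one_mul]
    ring
  rw [e]
  calc _ ≤ |newWeight s m 0 * (g h - g 0)| + |x h - g 0| := abs_sub _ _
    _ ≤ m * V + V := by
      rw [abs_mul, abs_of_nonneg hq0]
      gcongr
      exact hV h ⟨hh.le, le_rfl⟩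
    _ = _ := by ring

/-- The error of a method is bounded by the total oscillation of the input over the steps. A
consistency error in step `k` is proportional to `x - g` at time `k h`, which is not small; but the
exact solution forgets the past variation of `g`, which makes the sum of these errors finite. -/
lemma exists_scalar_error_le (s : Scheme) {m : ℕ} (hm : 1 ≤ m) : ∃ C : ℝ, ∀ (T h : ℝ)
    (g x : ℝ → ℝ) (V : ℕ → ℝ) (n : ℕ), IsScalarSolution m T g x → 0 < h → (n + 1) * h ≤ T →
    (∀ k ≤ n, ∀ t ∈ Set.Icc (k * h) ((k + 1) * h), |g t - g (k * h)| ≤ V k) →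
    (n + 1) * |scalarIterate s m g h (n + 1) - x ((n + 1) * h)|
      ≤ C * ∑ k ∈ Finset.range (n + 1), V k := by
  obtain ⟨K, hK0, hK⟩ := exists_decay_sub_le s m
  refine ⟨Real.exp K * ((m + 1) + (2 * K + 2 * m)), fun T h g x V n hx hh hT hV => ?_⟩
  have hV0 : ∀ k ≤ n, 0 ≤ V k := fun k hk =>
    (abs_nonneg _).trans (hV k hk (k * h) ⟨le_rfl, by nlinarith⟩)
  have hkT : ∀ k ≤ n, ((k : ℝ) + 1) * h ≤ T := fun k hk => by
    refine le_trans ?_ hT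
    gcongr
  have hg : ∀ k ≤ n, |g ((k + 1) * h) - g (k * h)| ≤ V k := fun k hk =>
    hV k hk _ ⟨by nlinarith, le_rfl⟩
  -- The exact step, and the resulting decay of the distance between solution and input.
  have hstep : ∀ k ≤ n, |(x ((k + 1) * h) - g (k * h))
      - ((k : ℝ) / (k + 1)) ^ m * (x (k * h) - g (k * h))|
      ≤ V k * (1 - ((k : ℝ) / (k + 1)) ^ m) := fun k hk => by
    simpa using hx.abs_step_sub_le hm hh (hkT k hk) (α := g (k * h)) (β := 0) (D := V k)
      (by simpa using hV k hk)
  obtain ⟨E, hE⟩ : ∃ E : ℕ → ℝ, E = fun k : ℕ => x (k * h) - g (k * h) := ⟨_, rfl⟩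
  have hEk : ∀ k : ℕ, x (k * h) - g (k * h) = E k := fun k => by rw [hE]
  have hErec : ∀ k ≤ n, |E (k + 1)| ≤ k / (k + 1) * |E k| + 2 * V k := fun k hk => by
    have h1 := hstep k hk
    rw [hEk] at h1
    have e : E (k + 1) = ((x ((k + 1) * h) - g (k * h)) - ((k : ℝ) / (k + 1)) ^ m * E k)
        + ((k : ℝ) / (k + 1)) ^ m * E k - (g ((k + 1) * h) - g (k * h)) := by
      rw [hE]; push_cast; ring
    have h2 : |((k : ℝ) / (k + 1)) ^ m * E k| ≤ k / (k + 1) * |E k| := by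
      rw [abs_mul, abs_of_nonneg (by positivity : 0 ≤ ((k : ℝ) / (k + 1)) ^ m)]
      gcongr
      exact div_succ_pow_le hm k
    have h3 : V k * (1 - ((k : ℝ) / (k + 1)) ^ m) ≤ V k :=
      mul_le_of_le_one_right (hV0 k hk) (sub_le_self _ (by positivity))
    rw [e]
    refine (abs_sub _ _).trans ?_
    have := abs_add_le ((x ((k + 1) * h) - g (k * h)) - ((k : ℝ) / (k + 1)) ^ m * E k)
      (((k : ℝ) / (k + 1)) ^ m * E k)
    linarith [hg k hk]
  have hEsum : ∀ j ≤ n, ∑ i ∈ Finset.range j, |E (i + 1)| / (i + 2) + |E (j + 1)|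
      ≤ 2 * ∑ k ∈ Finset.range (j + 1), V k := by
    intro j
    induction j with
    | zero => intro h0; simpa using hErec 0 h0
    | succ j ih =>
      intro hj
      have h1 := ih (by omega)
      have h2 := hErec (j + 1) hj
      rw [Finset.sum_range_succ, Finset.sum_range_succ _ (j + 1), mul_add]
      push_cast at h2 ⊢
      have e : ((j : ℝ) + 1) / (j + 1 + 1) * |E (j + 1)|
          = |E (j + 1)| - |E (j + 1)| / (j + 2) := by
        field_simp; ring
      linarith
  obtain ⟨τ, hτ⟩ : ∃ τ : ℕ → ℝ, τ = fun k : ℕ =>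
      (decay s m k - ((k : ℝ) / (k + 1)) ^ m) * E k
        + newWeight s m k * (g ((k + 1) * h) - g (k * h))
        - ((x ((k + 1) * h) - g (k * h)) - ((k : ℝ) / (k + 1)) ^ m * E k) := ⟨_, rfl⟩
  have herr := succ_mul_abs_error_le (R := decay s m) (τ := τ) (K := K)
    (e := fun k => scalarIterate s m g h k - x (k * h)) hK0 n
    (fun k hk => abs_decay_le hm (hK k hk)) (fun k _ _ => by
      simp only [scalarIterate, hτ, hE]; push_cast; ring)
  have hτle : ∀ j < n, ((j : ℝ) + 2) * |τ (j + 1)|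
      ≤ K * (|E (j + 1)| / (j + 2)) + 2 * m * V (j + 1) := fun j hj => by
    have h1 := hstep (j + 1) hj
    have h2 := hK (j + 1) (by omega)
    have h3 := hg (j + 1) hj
    have h4 := newWeight_le s m (j + 1)
    have h5 := one_sub_div_succ_pow_le m (j + 1)
    have h6 := newWeight_nonneg s m (j + 1)
    have hVj := hV0 (j + 1) hj
    rw [hEk] at h1
    have hτ1 : |τ (j + 1)| ≤ K / ((j + 1 : ℕ) + 1) ^ 2 * |E (j + 1)|
        + m / ((j + 1 : ℕ) + 1) * V (j + 1) + V (j + 1) * (m / ((j + 1 : ℕ) + 1)) := by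
      rw [hτ]
      refine (abs_sub _ _).trans (add_le_add ((abs_add_le _ _).trans (add_le_add ?_ ?_)) ?_)
      · rw [abs_mul]; gcongr
      · rw [abs_mul, abs_of_nonneg h6]; gcongr
      · exact h1.trans (mul_le_mul_of_nonneg_left h5 hVj)
    push_cast at hτ1
    calc ((j : ℝ) + 2) * |τ (j + 1)| ≤ (j + 2) * (K / (j + 1 + 1) ^ 2 * |E (j + 1)|
        + m / (j + 1 + 1) * V (j + 1) + V (j + 1) * (m / (j + 1 + 1))) := by gcongr
      _ = _ := by
        have : (j : ℝ) + 1 + 1 = j + 2 := by ring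
        rw [this]
        field_simp
        ring
  have hsumτ : ∑ j ∈ Finset.range n, ((j : ℝ) + 2) * |τ (j + 1)|
      ≤ (2 * K + 2 * m) * ∑ k ∈ Finset.range (n + 1), V k := by
    refine (Finset.sum_le_sum fun j hj => hτle j (Finset.mem_range.1 hj)).trans ?_
    rw [Finset.sum_add_distrib, ← Finset.mul_sum, ← Finset.mul_sum]
    have h1 : ∑ i ∈ Finset.range n, |E (i + 1)| / ((i : ℝ) + 2)
        ≤ 2 * ∑ k ∈ Finset.range (n + 1), V k := by
      linarith [hEsum n le_rfl, abs_nonneg (E (n + 1))]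
    have h2 : ∑ i ∈ Finset.range n, V (i + 1) ≤ ∑ k ∈ Finset.range (n + 1), V k := by
      rw [Finset.sum_range_succ' V]
      linarith [hV0 0 (Nat.zero_le n)]
    have h3 := mul_le_mul_of_nonneg_left h1 hK0
    have h4 := mul_le_mul_of_nonneg_left h2 (by positivity : (0 : ℝ) ≤ 2 * m)
    linarith
  have hfirst : |scalarIterate s m g h 1 - x h| ≤ (m + 1) * ∑ k ∈ Finset.range (n + 1), V k := by
    refine (abs_scalarIterate_one_sub_le hm s hx hh (by simpa using hkT 0 (Nat.zero_le n))
      (by simpa using hV 0 (Nat.zero_le n))).trans ?_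
    gcongr
    exact Finset.single_le_sum (f := V)
      (fun k hk => hV0 k (Nat.lt_succ_iff.1 (Finset.mem_range.1 hk))) (by simp)
  push_cast at herr
  rw [one_mul] at herr
  refine herr.trans ?_
  rw [mul_assoc (Real.exp K)]
  gcongr
  linarith

/-- The bilinear method integrates the exact solution for a linear input without error, except in
the first step. -/
lemma bilinear_linear_exact (m : ℕ) {k : ℕ} (hk : 1 ≤ k) (α β h : ℝ) :
    decay .bilinear m k * (α + m / (m + 1) * β * (k * h))
      + (1 - decay .bilinear m k - newWeight .bilinear m k) * (α + β * (k * h))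
      + newWeight .bilinear m k * (α + β * ((k + 1) * h))
      = α + m / (m + 1) * β * ((k + 1) * h) := by
  have hk' : (0 : ℝ) < k := by exact_mod_cast hk
  have : (0 : ℝ) < 2 * (k + 1) + m := by positivity
  have : (0 : ℝ) < 1 + m / (2 * (k + 1)) := by positivity
  simp only [decay, newWeight]
  field_simp
  ring

/-- For an input with Lipschitz derivative the bilinear method has an error of second order: on
each step the input is replaced by its tangent at the left end point. -/
lemma exists_scalar_bilinear_error_le {m : ℕ} (hm : 1 ≤ m) : ∃ C : ℝ, ∀ (T h M : ℝ)
    (g g' x : ℝ → ℝ) (n : ℕ), IsScalarSolution m T g x → 0 < h → (n + 1) * h ≤ T → 0 ≤ M →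
    (∀ t ∈ Set.Icc 0 T, |g t - g 0| ≤ M * t) →
    (∀ a ∈ Set.Icc 0 T, ∀ t ∈ Set.Icc 0 T, |g t - (g a + g' a * (t - a))| ≤ M * (t - a) ^ 2) →
    (n + 1) * |scalarIterate .bilinear m g h (n + 1) - x ((n + 1) * h)| ≤ C * M * (1 + T) * h := by
  obtain ⟨K, hK0, hK⟩ := exists_decay_sub_le .bilinear m
  obtain ⟨L, hL0, hL⟩ := exists_decay_bilinear_sub_le m
  refine ⟨Real.exp K * ((m + 1) + (L + 2 * m)), fun T h M g g' x n hx hh hT hM hg1 hg2 => ?_⟩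
  have hkT : ∀ k ≤ n, ((k : ℝ) + 1) * h ≤ T := fun k hk => by
    refine le_trans ?_ hT
    gcongr
  have hT0 : 0 < T := lt_of_lt_of_le (by positivity) hT
  -- The distance of the solution from the exact solution `ℓ k` for the tangent at `k h`.
  obtain ⟨ℓ, hℓ⟩ : ∃ ℓ : ℕ → ℝ → ℝ, ℓ = fun (k : ℕ) t =>
      (g (k * h) - g' (k * h) * (k * h)) + m / (m + 1) * g' (k * h) * t := ⟨_, rfl⟩
  have hmem : ∀ k ≤ n, (k * h : ℝ) ∈ Set.Icc 0 T := fun k hk =>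
    ⟨by positivity, by nlinarith [hkT k hk]⟩
  have htan : ∀ k ≤ n, ∀ t ∈ Set.Icc 0 T,
      |g t - ((g (k * h) - g' (k * h) * (k * h)) + g' (k * h) * t)| ≤ M * (t - k * h) ^ 2 :=
    fun k hk t ht => by
      convert hg2 (k * h) (hmem k hk) t ht using 2
      ring
  have hyk : ∀ k ≤ n, 1 ≤ k → |x (k * h) - ℓ k (k * h)| ≤ M * (k * h) ^ 2 := fun k hk hk1 => by
    have hk1' : (0 : ℝ) < k := by exact_mod_cast hk1
    have H := hx.abs_pow_mul_sub_le hm le_rfl (hmem k hk).1 (hmem k hk).2 (D := M * (k * h) ^ 2)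
      (fun t ht => (htan k hk t ⟨ht.1, ht.2.trans (hmem k hk).2⟩).trans
        (mul_le_mul_of_nonneg_left (by nlinarith [ht.1, ht.2]) hM))
    have hp : 0 < ((k : ℝ) * h) ^ m := by positivity
    rw [zero_pow (by omega), zero_mul, sub_zero, sub_zero, abs_mul, abs_of_pos hp, mul_comm] at H
    rw [hℓ]
    exact le_of_mul_le_mul_right H hp
  have hstep : ∀ k ≤ n, |(x ((k + 1) * h) - ℓ k ((k + 1) * h))
      - ((k : ℝ) / (k + 1)) ^ m * (x (k * h) - ℓ k (k * h))|
      ≤ M * h ^ 2 * (m / (k + 1)) := fun k hk => by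
    have H := hx.abs_step_sub_le hm hh (hkT k hk) (D := M * h ^ 2)
      (fun t ht => (htan k hk t ⟨(hmem k hk).1.trans ht.1, ht.2.trans (hkT k hk)⟩).trans
        (mul_le_mul_of_nonneg_left (by nlinarith [ht.1, ht.2]) hM))
    rw [hℓ]
    exact H.trans (mul_le_mul_of_nonneg_left (one_sub_div_succ_pow_le m k) (by positivity))
  have hend : ∀ k ≤ n, |g ((k + 1) * h)
      - ((g (k * h) - g' (k * h) * (k * h)) + g' (k * h) * ((k + 1) * h))| ≤ M * h ^ 2 :=
    fun k hk => by
      convert htan k hk ((k + 1) * h) ⟨by positivity, hkT k hk⟩ using 1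
      ring
  obtain ⟨τ, hτ⟩ : ∃ τ : ℕ → ℝ, τ = fun k : ℕ =>
      (decay .bilinear m k - ((k : ℝ) / (k + 1)) ^ m) * (x (k * h) - ℓ k (k * h))
        + newWeight .bilinear m k * (g ((k + 1) * h)
          - ((g (k * h) - g' (k * h) * (k * h)) + g' (k * h) * ((k + 1) * h)))
        - ((x ((k + 1) * h) - ℓ k ((k + 1) * h))
          - ((k : ℝ) / (k + 1)) ^ m * (x (k * h) - ℓ k (k * h))) := ⟨_, rfl⟩
  have herr := succ_mul_abs_error_le (R := decay .bilinear m) (τ := τ) (K := K)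
    (e := fun k => scalarIterate .bilinear m g h k - x (k * h)) hK0 n
    (fun k hk => abs_decay_le hm (hK k hk)) (fun k hk _ => by
      have e := bilinear_linear_exact m hk (g (k * h) - g' (k * h) * (k * h)) (g' (k * h)) h
      simp only [scalarIterate, hτ, hℓ]
      push_cast
      linear_combination e)
  have hτle : ∀ j < n, ((j : ℝ) + 2) * |τ (j + 1)| ≤ (L + 2 * m) * M * h ^ 2 := fun j hj => by
    have h1 := hstep (j + 1) hj
    have h2 := hL (j + 1) (by omega)
    have h3 := hend (j + 1) hj
    have h4 := newWeight_le .bilinear m (j + 1)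
    have h6 := newWeight_nonneg .bilinear m (j + 1)
    have h7 := hyk (j + 1) hj (by omega)
    have hτ1 : |τ (j + 1)| ≤ L / ((j + 1 : ℕ) + 1) ^ 3 * (M * ((j + 1 : ℕ) * h) ^ 2)
        + m / ((j + 1 : ℕ) + 1) * (M * h ^ 2) + M * h ^ 2 * (m / ((j + 1 : ℕ) + 1)) := by
      rw [hτ]
      refine (abs_sub _ _).trans (add_le_add ((abs_add_le _ _).trans (add_le_add ?_ ?_)) h1)
      · rw [abs_mul]; gcongr
      · rw [abs_mul, abs_of_nonneg h6]; gcongr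
    push_cast at hτ1
    calc ((j : ℝ) + 2) * |τ (j + 1)| ≤ (j + 2) * (L / (j + 1 + 1) ^ 3 * (M * ((j + 1) * h) ^ 2)
        + m / (j + 1 + 1) * (M * h ^ 2) + M * h ^ 2 * (m / (j + 1 + 1))) := by gcongr
      _ ≤ (j + 2) * (L / (j + 1 + 1) ^ 3 * (M * ((j + 1 + 1) * h) ^ 2)
        + m / (j + 1 + 1) * (M * h ^ 2) + M * h ^ 2 * (m / (j + 1 + 1))) := by
          gcongr
          linarith
      _ = _ := by
        have : (j : ℝ) + 1 + 1 = j + 2 := by ring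
        rw [this]
        field_simp
        ring
  have hsumτ : ∑ j ∈ Finset.range n, ((j : ℝ) + 2) * |τ (j + 1)|
      ≤ (L + 2 * m) * M * h * T := by
    refine (Finset.sum_le_sum fun j hj => hτle j (Finset.mem_range.1 hj)).trans ?_
    rw [Finset.sum_const, Finset.card_range, nsmul_eq_mul]
    calc n * ((L + 2 * m) * M * h ^ 2) = (L + 2 * m) * M * h * (n * h) := by ring
      _ ≤ _ := by
        gcongr
        exact (hmem n le_rfl).2
  have hfirst : |scalarIterate .bilinear m g h 1 - x h| ≤ (m + 1) * (M * h) := by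
    have hhT : h ≤ T := by simpa using hkT 0 (Nat.zero_le n)
    refine abs_scalarIterate_one_sub_le hm _ hx hh hhT fun t ht => ?_
    exact (hg1 t ⟨ht.1, ht.2.trans hhT⟩).trans (mul_le_mul_of_nonneg_left ht.2 hM)
  push_cast at herr
  rw [one_mul] at herr
  refine herr.trans ?_
  calc _ ≤ Real.exp K * ((m + 1) * (M * h) + (L + 2 * m) * M * h * T) := by gcongr
    _ ≤ Real.exp K * ((m + 1) * (M * h) + (L + 2 * m) * M * h * T
        + ((m + 1) * M * h * T + (L + 2 * m) * M * h)) := by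
      refine mul_le_mul_of_nonneg_left ?_ (Real.exp_pos K).le
      exact le_add_of_nonneg_right (by positivity)
    _ = _ := by ring

/-! ### Diagonalization -/

lemma A_isLowerTriangular (N : ℕ) : (A N).IsLowerTriangular := by
  intro i j hij
  have hij' : i < j := hij
  simp [A, hij'.not_gt, hij'.ne]

lemma A_diag (N : ℕ) (i : Fin N) : A N i i = (i : ℕ) + 1 := by simp [A]

/-- Constant functions are solutions: `c = e₁` solves the equation with `f = 1`. -/
lemma A_mulVec_e₁ (N : ℕ) : A N *ᵥ e₁ N = B N := by
  ext i
  have hN : 0 < N := i.pos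
  have h0 : ∀ j : Fin N, (j : ℕ) = 0 ↔ j = ⟨0, hN⟩ := fun j => by rw [Fin.ext_iff]
  simp only [Matrix.mulVec, dotProduct, e₁, h0, mul_ite, mul_one, mul_zero, Finset.sum_ite_eq',
    Finset.mem_univ, if_true]
  by_cases hi : i = ⟨0, hN⟩
  · subst hi; simp [A, B]
  · have : (⟨0, hN⟩ : Fin N) < i := by
      rw [Fin.lt_def]; exact Nat.pos_of_ne_zero fun h => hi (Fin.ext h)
    simp [A, B, this]

/-- The diagonal entries `1, …, N` of the triangular matrix `A` are distinct, so `A` has a basis of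
left eigenvectors, the rows of `W`. -/
lemma exists_diagonalization (N : ℕ) : ∃ W : Matrix (Fin N) (Fin N) ℝ, IsUnit W ∧
    W * A N = Matrix.diagonal (fun i : Fin N => ((i : ℕ) : ℝ) + 1) * W := by
  have hex : ∀ i : Fin N, ∃ w : Fin N → ℝ, w ≠ 0 ∧ w ᵥ* A N = (((i : ℕ) : ℝ) + 1) • w := by
    intro i
    have hdet : (A N - (((i : ℕ) : ℝ) + 1) • (1 : Matrix (Fin N) (Fin N) ℝ)).det = 0 := by
      rw [Matrix.det_of_isLowerTriangular]
      · refine Finset.prod_eq_zero (Finset.mem_univ i) ?_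
        simp [A_diag]
      · intro j k hjk
        have hjk' : j < k := hjk
        have := A_isLowerTriangular N hjk
        simp [this, Matrix.one_apply_ne hjk'.ne]
    obtain ⟨w, hw, h⟩ := Matrix.exists_vecMul_eq_zero_iff.2 hdet
    refine ⟨w, hw, ?_⟩
    rw [Matrix.vecMul_sub, Matrix.vecMul_smul, Matrix.vecMul_one] at h
    exact sub_eq_zero.1 h
  choose w hw0 hw using hex
  refine ⟨Matrix.of w, ?_, ?_⟩
  · rw [← Matrix.linearIndependent_rows_iff_isUnit]
    refine Module.End.eigenvectors_linearIndependent' (Matrix.toLin' (A N)ᵀ)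
      (fun i : Fin N => ((i : ℕ) : ℝ) + 1) (fun i j hij => ?_) w fun i => ?_
    · exact Fin.ext (by simpa using hij)
    · rw [Module.End.hasEigenvector_iff, Module.End.mem_eigenspace_iff, Matrix.toLin'_apply,
        Matrix.mulVec_transpose]
      exact ⟨hw i, hw0 i⟩
  · ext i j
    rw [Matrix.diagonal_mul]
    exact congrFun (hw i) j

lemma row_vecMul_of_mul_eq {N : ℕ} {W M : Matrix (Fin N) (Fin N) ℝ} {d : Fin N → ℝ}
    (h : W * M = Matrix.diagonal d * W) (i : Fin N) : W i ᵥ* M = d i • W i := by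
  ext j
  have := congrFun (congrFun h i) j
  rwa [Matrix.diagonal_mul] at this

section Eigenvector

variable {N m : ℕ} {w : Fin N → ℝ}

lemma isUnit_det_one_add_smul_A (N : ℕ) {a : ℝ} (ha : 0 ≤ a) : IsUnit (1 + a • A N).det := by
  rw [Matrix.det_of_isLowerTriangular]
  · refine (Finset.prod_ne_zero_iff.2 fun i _ => ?_).isUnit
    have : 0 < 1 + a * (((i : ℕ) : ℝ) + 1) := by positivity
    simpa [A_diag] using this.ne'
  · intro i j hij
    have hij' : i < j := hij
    have := A_isLowerTriangular N hij
    simp [this, Matrix.one_apply_ne hij'.ne]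

lemma isUnit_det_A (N : ℕ) : IsUnit (A N).det := by
  rw [Matrix.det_of_isLowerTriangular _ (A_isLowerTriangular N)]
  refine (Finset.prod_ne_zero_iff.2 fun i _ => ?_).isUnit
  rw [A_diag]
  positivity

lemma dotProduct_A_mulVec (hw : w ᵥ* A N = (m : ℝ) • w) (v : Fin N → ℝ) :
    w ⬝ᵥ (A N *ᵥ v) = m * (w ⬝ᵥ v) := by
  rw [Matrix.dotProduct_mulVec, hw, smul_dotProduct, smul_eq_mul]

lemma dotProduct_B (hw : w ᵥ* A N = (m : ℝ) • w) : w ⬝ᵥ B N = m * (w ⬝ᵥ e₁ N) := by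
  rw [← A_mulVec_e₁, dotProduct_A_mulVec hw]

lemma dotProduct_one_add_mulVec (hw : w ᵥ* A N = (m : ℝ) • w) (a : ℝ) (v : Fin N → ℝ) :
    w ⬝ᵥ ((1 + a • A N) *ᵥ v) = (1 + a * m) * (w ⬝ᵥ v) := by
  rw [Matrix.add_mulVec, Matrix.one_mulVec, Matrix.smul_mulVec, dotProduct_add, dotProduct_smul,
    dotProduct_A_mulVec hw, smul_eq_mul]
  ring

lemma dotProduct_one_sub_mulVec (hw : w ᵥ* A N = (m : ℝ) • w) (a : ℝ) (v : Fin N → ℝ) :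
    w ⬝ᵥ ((1 - a • A N) *ᵥ v) = (1 - a * m) * (w ⬝ᵥ v) := by
  rw [Matrix.sub_mulVec, Matrix.one_mulVec, Matrix.smul_mulVec, dotProduct_sub, dotProduct_smul,
    dotProduct_A_mulVec hw, smul_eq_mul]
  ring

lemma dotProduct_inv_one_add_mulVec (hw : w ᵥ* A N = (m : ℝ) • w) {a : ℝ} (ha : 0 ≤ a)
    (v : Fin N → ℝ) : w ⬝ᵥ ((1 + a • A N)⁻¹ *ᵥ v) = (w ⬝ᵥ v) / (1 + a * m) := by
  have h := dotProduct_one_add_mulVec hw a ((1 + a • A N)⁻¹ *ᵥ v)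
  rw [Matrix.mulVec_mulVec, Matrix.mul_nonsing_inv _ (isUnit_det_one_add_smul_A N ha),
    Matrix.one_mulVec] at h
  rw [h, mul_div_cancel_left₀]
  positivity

lemma dotProduct_inv_A_mulVec (hw : w ᵥ* A N = (m : ℝ) • w) (hm : 1 ≤ m) (v : Fin N → ℝ) :
    w ⬝ᵥ ((A N)⁻¹ *ᵥ v) = (w ⬝ᵥ v) / m := by
  have h := dotProduct_A_mulVec hw ((A N)⁻¹ *ᵥ v)
  rw [Matrix.mulVec_mulVec, Matrix.mul_nonsing_inv _ (isUnit_det_A N), Matrix.one_mulVec] at h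
  rw [h, mul_div_cancel_left₀]
  exact_mod_cast (by omega : m ≠ 0)

end Eigenvector

lemma mul_zohMatrix {N : ℕ} {W : Matrix (Fin N) (Fin N) ℝ} (hW : IsUnit W)
    (hWA : W * A N = Matrix.diagonal (fun i : Fin N => ((i : ℕ) : ℝ) + 1) * W) (k : ℕ) :
    W * zohMatrix N k
      = Matrix.diagonal (fun i : Fin N => ((k : ℝ) / (k + 1)) ^ ((i : ℕ) + 1)) * W := by
  by_cases hk : k = 0
  · subst hk
    simp [zohMatrix]
  have hk' : (0 : ℝ) < (k : ℝ) / (k + 1) := by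
    have : (0 : ℝ) < k := by exact_mod_cast Nat.pos_of_ne_zero hk
    positivity
  have hdet : IsUnit W.det := (Matrix.isUnit_iff_isUnit_det W).1 hW
  have hA : Real.log ((k : ℝ) / (k + 1)) • A N
      = W⁻¹ * Matrix.diagonal
        (fun i : Fin N => Real.log ((k : ℝ) / (k + 1)) * (((i : ℕ) : ℝ) + 1)) * W := by
    have h1 : A N = W⁻¹ * (Matrix.diagonal (fun i : Fin N => ((i : ℕ) : ℝ) + 1) * W) := by
      rw [← hWA, Matrix.nonsing_inv_mul_cancel_left _ _ hdet]
    have h2 : Matrix.diagonal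
        (fun i : Fin N => Real.log ((k : ℝ) / (k + 1)) * (((i : ℕ) : ℝ) + 1))
        = Real.log ((k : ℝ) / (k + 1)) • Matrix.diagonal (fun i : Fin N => ((i : ℕ) : ℝ) + 1) := by
      rw [← Matrix.diagonal_smul]; rfl
    conv_lhs => rw [h1]
    rw [h2, Matrix.mul_smul, Matrix.smul_mul, Matrix.mul_assoc]
  rw [zohMatrix, if_neg hk, hA, Matrix.exp_conj' _ _ hW, Matrix.mul_assoc,
    Matrix.mul_nonsing_inv_cancel_left _ _ hdet, Matrix.exp_diagonal]
  congr 2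
  ext i
  rw [Pi.coe_exp, ← Real.exp_eq_exp_ℝ, mul_comm, ← Nat.cast_succ, Real.exp_nat_mul,
    Real.exp_log hk']

/-- Applied to a left eigenvector for the eigenvalue `m`, every method becomes its scalar form. -/
lemma row_dotProduct_iterate {N : ℕ} {W : Matrix (Fin N) (Fin N) ℝ} (hW : IsUnit W)
    (hWA : W * A N = Matrix.diagonal (fun i : Fin N => ((i : ℕ) : ℝ) + 1) * W) (s : Scheme)
    (f : ℝ → ℝ) (h : ℝ) (i : Fin N) (k : ℕ) :
    W i ⬝ᵥ iterate N s f h k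
      = scalarIterate s ((i : ℕ) + 1) (fun t => (W i ⬝ᵥ e₁ N) * f t) h k := by
  have hw : W i ᵥ* A N = (((i : ℕ) + 1 : ℕ) : ℝ) • W i := by
    simpa using row_vecMul_of_mul_eq hWA i
  have hz : ∀ (k : ℕ) (v : Fin N → ℝ), W i ⬝ᵥ (zohMatrix N k *ᵥ v)
      = ((k : ℝ) / (k + 1)) ^ ((i : ℕ) + 1) * (W i ⬝ᵥ v) := by
    intro k v
    have h1 : W i ᵥ* zohMatrix N k = ((k : ℝ) / (k + 1)) ^ ((i : ℕ) + 1) • W i :=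
      row_vecMul_of_mul_eq (mul_zohMatrix hW hWA k) i
    rw [Matrix.dotProduct_mulVec, h1, smul_dotProduct, smul_eq_mul]
  have hm1 : 1 ≤ (i : ℕ) + 1 := by omega
  generalize (i : ℕ) + 1 = m at hw hz hm1 ⊢
  have hm0 : (0 : ℝ) < m := by exact_mod_cast hm1
  induction k with
  | zero => simp [iterate, scalarIterate, dotProduct_smul, mul_comm]
  | succ k ih =>
    have hk1 : (0 : ℝ) ≤ 1 / ((k : ℝ) + 1) := by positivity
    have hk2 : (0 : ℝ) ≤ 1 / (2 * ((k : ℝ) + 1)) := by positivity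
    have hp1 : (0 : ℝ) < k + 1 + m := by positivity
    have hp2 : (0 : ℝ) < 2 * (k + 1) + m := by positivity
    have hp3 : (0 : ℝ) < 2 + m := by positivity
    rw [iterate, scalarIterate, ← ih]
    generalize iterate N s f h k = v
    cases s
    case forwardEuler =>
      by_cases hk : k = 0
      · simp [step, hk, decay, newWeight]
      have hk0 : (0 : ℝ) < k := by exact_mod_cast Nat.pos_of_ne_zero hk
      simp only [step, hk, if_false, dotProduct_add, dotProduct_smul,
        dotProduct_one_sub_mulVec hw, dotProduct_B hw, smul_eq_mul, decay, newWeight]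
      field_simp
      ring
    case backwardEuler =>
      simp only [step, dotProduct_add, dotProduct_inv_one_add_mulVec hw hk1, dotProduct_smul,
        dotProduct_B hw, smul_eq_mul, decay, newWeight]
      field_simp
      ring
    case bilinear =>
      by_cases hk : k = 0
      · simp only [step, hk, if_true, dotProduct_add, dotProduct_smul, dotProduct_B hw, smul_eq_mul,
          dotProduct_inv_one_add_mulVec hw (by norm_num : (0 : ℝ) ≤ 1 / 2), decay, newWeight,
          Nat.cast_zero, mul_zero, div_zero, zero_add, mul_one, sub_zero, zero_mul, one_mul]
        field_simp
        ring
      have hk0 : (0 : ℝ) < k := by exact_mod_cast Nat.pos_of_ne_zero hk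
      simp only [step, hk, if_false, dotProduct_add, dotProduct_smul,
        dotProduct_inv_one_add_mulVec hw hk2,
        dotProduct_one_sub_mulVec hw, dotProduct_B hw, smul_eq_mul, decay, newWeight]
      field_simp
      ring
    case approxBilinear =>
      simp only [step, dotProduct_add, dotProduct_smul,
        dotProduct_inv_one_add_mulVec hw hk2,
        dotProduct_one_sub_mulVec hw, dotProduct_B hw, smul_eq_mul, decay, newWeight]
      field_simp
      ring
    case zeroOrderHold =>
      simp only [step, dotProduct_add, dotProduct_inv_A_mulVec hw hm1, Matrix.sub_mulVec,
        Matrix.one_mulVec, dotProduct_sub, dotProduct_smul, hz, dotProduct_B hw, smul_eq_mul,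
        decay, newWeight]
      field_simp
      ring

lemma absolutelyContinuousOnInterval_dotProduct {N : ℕ} {c : ℝ → Fin N → ℝ} {a b : ℝ}
    (hc : AbsolutelyContinuousOnInterval c a b) (w : Fin N → ℝ) :
    AbsolutelyContinuousOnInterval (fun t => w ⬝ᵥ c t) a b := by
  have hL : ∀ u v : Fin N → ℝ, dist (w ⬝ᵥ u) (w ⬝ᵥ v) ≤ (∑ i, |w i|) * dist u v := by
    intro u v
    rw [Real.dist_eq, ← dotProduct_sub, Finset.sum_mul]
    refine (Finset.abs_sum_le_sum_abs _ _).trans (Finset.sum_le_sum fun i _ => ?_)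
    rw [abs_mul]
    gcongr
    exact dist_le_pi_dist u v i
  refine squeeze_zero (fun E => Finset.sum_nonneg fun i _ => dist_nonneg) (fun E => ?_)
    (by simpa using Tendsto.const_mul (∑ i, |w i|) hc)
  rw [Finset.mul_sum]
  exact Finset.sum_le_sum fun i _ => hL _ _

lemma IsSolution.isScalarSolution {N m : ℕ} {T : ℝ} {f : ℝ → ℝ} {c₀ : Fin N → ℝ}
    {c : ℝ → Fin N → ℝ} (hc : IsSolution N T f c₀ c) {w : Fin N → ℝ}
    (hw : w ᵥ* A N = (m : ℝ) • w) :
    IsScalarSolution m T (fun t => (w ⬝ᵥ e₁ N) * f t) (fun t => w ⬝ᵥ c t) where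
  continuousOn := by
    have h := hc.continuousOn
    exact (continuous_const.dotProduct continuous_id).comp_continuousOn h
  absolutelyContinuous ε hε :=
    absolutelyContinuousOnInterval_dotProduct (hc.absolutelyContinuous ε hε) w
  ode := by
    filter_upwards [hc.ode] with t ht
    have h1 : HasDerivAt (fun t => w ⬝ᵥ c t)
        (w ⬝ᵥ (-(1 / t) • (A N *ᵥ c t) + (1 / t) • (f t • B N))) t := by
      rw [hasDerivAt_pi] at ht
      exact HasDerivAt.fun_sum fun i _ => (ht i).const_mul (w i)
    refine h1.congr_deriv ?_
    rw [dotProduct_add, dotProduct_smul, dotProduct_smul, dotProduct_smul, dotProduct_A_mulVec hw,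
      dotProduct_B hw]
    simp only [smul_eq_mul]
    ring

/-! ### Oscillation and Taylor estimates for the input -/

lemma sum_eVariationOn_steps (f : ℝ → ℝ) {h : ℝ} (hh : 0 ≤ h) (n : ℕ) :
    ∑ k ∈ Finset.range n, eVariationOn f (Set.Icc (k * h) ((k + 1) * h))
      = eVariationOn f (Set.Icc 0 (n * h)) := by
  induction n with
  | zero => simp [eVariationOn.subsingleton]
  | succ n ih =>
    have := eVariationOn.Icc_add_Icc f (s := Set.univ) (a := 0) (b := n * h) (c := (n + 1) * h)
      (by positivity) (by nlinarith) (Set.mem_univ _)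
    rw [Finset.sum_range_succ, ih]
    simpa using this

/-- For a function of class `C²` on a compact interval, uniform bounds for the Taylor remainders of
order `0` at the left end point and of order `1` at every point. -/
lemma exists_taylor_bounds {f : ℝ → ℝ} {T : ℝ} (hT : 0 < T)
    (hf : ContDiffOn ℝ 2 f (Set.Icc 0 T)) : ∃ M : ℝ, 0 ≤ M ∧
      (∀ t ∈ Set.Icc 0 T, |f t - f 0| ≤ M * t) ∧
      ∀ a ∈ Set.Icc 0 T, ∀ t ∈ Set.Icc 0 T,
        |f t - (f a + derivWithin f (Set.Icc 0 T) a * (t - a))| ≤ M * (t - a) ^ 2 := by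
  obtain ⟨K, hK⟩ := hf.exists_lipschitzOnWith two_ne_zero (convex_Icc 0 T) isCompact_Icc
  obtain ⟨L, hL⟩ := (hf.derivWithin (m := 1) (uniqueDiffOn_Icc hT)
    (by norm_num)).exists_lipschitzOnWith one_ne_zero (convex_Icc 0 T) isCompact_Icc
  refine ⟨K + L, by positivity, fun t ht => ?_, fun a ha t ht => ?_⟩
  · have := hK.dist_le_mul t ht 0 ⟨le_rfl, hT.le⟩
    rw [Real.dist_eq, Real.dist_eq, sub_zero, abs_of_nonneg ht.1] at this
    nlinarith [mul_nonneg L.coe_nonneg ht.1]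
  · have hsub : Set.uIcc a t ⊆ Set.Icc 0 T := Set.uIcc_subset_Icc ha ht
    have h1 := (convex_uIcc a t).norm_image_sub_le_of_norm_hasDerivWithin_le
      (f := fun s => f s - derivWithin f (Set.Icc 0 T) a * s)
      (f' := fun s => derivWithin f (Set.Icc 0 T) s - derivWithin f (Set.Icc 0 T) a)
      (C := L * |t - a|) (x := a) (y := t) (fun s hs => by
        have hd := ((hf.differentiableOn two_ne_zero) s (hsub hs)).hasDerivWithinAt.mono hsub
        simpa using hd.fun_sub ((hasDerivWithinAt_id s _).const_mul
          (derivWithin f (Set.Icc 0 T) a))) (fun s hs => by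
        have := hL.dist_le_mul s (hsub hs) a ha
        rw [Real.dist_eq, Real.dist_eq] at this
        exact this.trans (mul_le_mul_of_nonneg_left (Set.abs_sub_left_of_mem_uIcc hs)
          L.coe_nonneg))
      Set.left_mem_uIcc Set.right_mem_uIcc
    rw [Real.norm_eq_abs, Real.norm_eq_abs, mul_assoc, ← sq, sq_abs] at h1
    calc _ = |f t - derivWithin f (Set.Icc 0 T) a * t
          - (f a - derivWithin f (Set.Icc 0 T) a * a)| := by congr 1; ring
      _ ≤ L * (t - a) ^ 2 := h1
      _ ≤ _ := by nlinarith [mul_nonneg K.coe_nonneg (sq_nonneg (t - a))]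

/-! ### Convergence -/

/-- A bound for the errors in all left eigendirections is a bound for the error. -/
lemma globalError_isBigO {N : ℕ} {W : Matrix (Fin N) (Fin N) ℝ} (hW : IsUnit W) (s : Scheme)
    {T : ℝ} {f : ℝ → ℝ} {c : ℝ → Fin N → ℝ} {u : ℕ → ℝ}
    (h : ∀ i, ∃ C, ∀ n : ℕ, |W i ⬝ᵥ iterate N s f (T / (n + 1 : ℕ)) (n + 1) - W i ⬝ᵥ c T|
      ≤ C * u (n + 1)) :
    (fun n : ℕ => globalError N s T f c n) =O[atTop] u := by
  have hdet : IsUnit W.det := (Matrix.isUnit_iff_isUnit_det W).1 hW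
  have hcomp : ∀ i, (fun n : ℕ => (W *ᵥ (iterate N s f (T / n) n - c T)) i) =O[atTop] u := by
    intro i
    obtain ⟨C, hC⟩ := h i
    refine IsBigO.of_bound |C| ?_
    filter_upwards [eventually_ge_atTop 1] with n hn
    obtain ⟨l, rfl⟩ : ∃ l, n = l + 1 := ⟨n - 1, by omega⟩
    have e : (W *ᵥ (iterate N s f (T / (l + 1 : ℕ)) (l + 1) - c T)) i
        = W i ⬝ᵥ iterate N s f (T / (l + 1 : ℕ)) (l + 1) - W i ⬝ᵥ c T := by
      rw [← dotProduct_sub]; rfl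
    rw [e, Real.norm_eq_abs, Real.norm_eq_abs, ← abs_mul]
    exact (hC l).trans (le_abs_self _)
  have hall : ∀ i, (fun n : ℕ => (iterate N s f (T / n) n - c T) i) =O[atTop] u := by
    intro i
    have e : ∀ n : ℕ, (iterate N s f (T / n) n - c T) i
        = ∑ j, W⁻¹ i j * (W *ᵥ (iterate N s f (T / n) n - c T)) j := by
      intro n
      conv_lhs => rw [← Matrix.one_mulVec (iterate N s f (T / n) n - c T),
        ← Matrix.nonsing_inv_mul W hdet, ← Matrix.mulVec_mulVec]
      rfl
    simp_rw [e]
    exact IsBigO.fun_sum fun j _ => (hcomp j).const_mul_left _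
  have hpi : (fun n : ℕ => iterate N s f (T / n) n - c T) =O[atTop] u := isBigO_pi.2 hall
  refine IsBigO.norm_left ?_
  exact ((PiLp.continuousLinearEquiv 2 ℝ
    (fun _ : Fin N => ℝ)).symm.toContinuousLinearMap.isBigO_comp _ _).trans hpi

end LegS

theorem mainTheorem4 (N : ℕ) (hN : 1 ≤ N) (T : ℝ) (hT : 0 < T) (f : ℝ → ℝ)
    (hf : BoundedVariationOn f (Set.Icc 0 T))
    (c₀ : Fin N → ℝ) (c : ℝ → Fin N → ℝ) (hc : LegS.IsSolution N T f c₀ c) :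
    (∀ s : LegS.Scheme,
      (fun n : ℕ => LegS.globalError N s T f c n) =O[atTop] fun n : ℕ => 1 / (n : ℝ)) ∧
    (ContDiffOn ℝ 2 f (Set.Icc 0 T) →
      (fun n : ℕ => LegS.globalError N .bilinear T f c n) =O[atTop]
        fun n : ℕ => 1 / (n : ℝ) ^ 2) := by
  obtain ⟨W, hW, hWA⟩ := LegS.exists_diagonalization N
  have hx : ∀ i : Fin N, LegS.IsScalarSolution ((i : ℕ) + 1) T
      (fun t => (W i ⬝ᵥ LegS.e₁ N) * f t) (fun t => W i ⬝ᵥ c t) := fun i =>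
    hc.isScalarSolution (by simpa using LegS.row_vecMul_of_mul_eq hWA i)
  have hnT : ∀ n : ℕ, ((n : ℝ) + 1) * (T / (n + 1 : ℕ)) = T := fun n => by
    push_cast
    field_simp
  refine ⟨fun s => LegS.globalError_isBigO hW s fun i => ?_,
    fun hf2 => LegS.globalError_isBigO hW _ fun i => ?_⟩
  · obtain ⟨C, hC⟩ := LegS.exists_scalar_error_le s (m := (i : ℕ) + 1) (by omega)
    refine ⟨C * (|W i ⬝ᵥ LegS.e₁ N| * (eVariationOn f (Set.Icc 0 T)).toReal), fun n => ?_⟩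
    obtain ⟨h, hh⟩ : ∃ h, h = T / (n + 1 : ℕ) := ⟨_, rfl⟩
    have hh0 : 0 < h := by rw [hh]; positivity
    have hnh : ((n : ℝ) + 1) * h = T := by rw [hh, hnT]
    have hsub : ∀ k ≤ n, Set.Icc (k * h) (((k : ℝ) + 1) * h) ⊆ Set.Icc 0 T := fun k hk =>
      Set.Icc_subset_Icc (by positivity) (by rw [← hnh]; gcongr)
    have H := hC T h _ _ (fun k => |W i ⬝ᵥ LegS.e₁ N|
      * (eVariationOn f (Set.Icc (k * h) ((k + 1) * h))).toReal) n (hx i) hh0 hnh.le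
      (fun k hk t ht => by
        rw [← mul_sub, abs_mul]
        gcongr
        exact (hf.mono (hsub k hk)).dist_le ht ⟨le_rfl, by nlinarith⟩)
    rw [← Finset.mul_sum, ← ENNReal.toReal_sum fun k hk =>
        hf.mono (hsub k (Nat.lt_succ_iff.1 (Finset.mem_range.1 hk))),
      LegS.sum_eVariationOn_steps f hh0.le, Nat.cast_succ, hnh] at H
    rw [LegS.row_dotProduct_iterate hW hWA, ← hh, mul_one_div, le_div_iff₀ (by positivity), mul_comm]
    push_cast
    exact H
  · obtain ⟨C, hC⟩ := LegS.exists_scalar_bilinear_error_le (m := (i : ℕ) + 1) (by omega)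
    obtain ⟨M, hM0, hM1, hM2⟩ := LegS.exists_taylor_bounds hT hf2
    refine ⟨C * (|W i ⬝ᵥ LegS.e₁ N| * M) * (1 + T) * T, fun n => ?_⟩
    obtain ⟨h, hh⟩ : ∃ h, h = T / (n + 1 : ℕ) := ⟨_, rfl⟩
    have hh0 : 0 < h := by rw [hh]; positivity
    have hnh : ((n : ℝ) + 1) * h = T := by rw [hh, hnT]
    have H := hC T h (|W i ⬝ᵥ LegS.e₁ N| * M) _
      (fun t => (W i ⬝ᵥ LegS.e₁ N) * derivWithin f (Set.Icc 0 T) t) _ n (hx i) hh0 hnh.le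
      (by positivity) (fun t ht => by
        rw [← mul_sub, abs_mul, mul_assoc]
        gcongr
        exact hM1 t ht) (fun a ha t ht => by
        rw [mul_assoc (_ ⬝ᵥ _), ← mul_add, ← mul_sub, abs_mul, mul_assoc |_|]
        gcongr
        exact hM2 a ha t ht)
    rw [hnh] at H
    rw [LegS.row_dotProduct_iterate hW hWA, ← hh, mul_one_div, le_div_iff₀ (by positivity)]
    calc _ = ((n : ℝ) + 1) * (((n : ℝ) + 1) * |LegS.scalarIterate .bilinear ((i : ℕ) + 1)
          (fun t => (W i ⬝ᵥ LegS.e₁ N) * f t) h (n + 1) - W i ⬝ᵥ c T|) := by push_cast; ring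
      _ ≤ ((n : ℝ) + 1) * (C * (|W i ⬝ᵥ LegS.e₁ N| * M) * (1 + T) * h) := by gcongr
      _ = C * (|W i ⬝ᵥ LegS.e₁ N| * M) * (1 + T) * (((n : ℝ) + 1) * h) := by ring
      _ = _ := by rw [hnh]
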